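/- Let $\mathfrak N$ be the set of locally finite simple configurations $\omega$ on $(0,+\infty)$ (finitely many atoms in each $(0,t]$), $N(\omega,t)=\omega([0,t])$ the counting process, also for $t=+\infty$, $\mathcal N_t=\sigma(N(s),\,s\le t)$ its (uncompleted) natural filtration, $\mathcal N_\infty=\bigvee_{t\ge 0}\mathcal N_t$, and $\pi$ the law on $(\mathfrak N,\mathcal N_\infty)$ of the unit rate Poisson process. Let $\dot y\in\mathcal P^{++}(\mathcal N,\pi)$, i.e. $\dot y$ is a positive real-valued $\mathcal N$-predictable process such that $y(\omega,t)=\int_0^t\dot y(\omega,s)\,ds$ satisfies $\pi(y(t)<+\infty)=1$ for every $t\ge0$ and $\pi(\lim_{t\to\infty}y(t)=+\infty)=1$. Let $y^*(\omega,t)=\inf\{s:\ y(\omega,s)>t\}\in[0,+\infty]$; for each $t$ it is an $\mathcal N$-stopping time. Put $Y(\omega,t)=N(\omega,y^*(\omega,t))$ and $\mathcal Y_t=\sigma(Y(u),\,u\le t)$. Let $\mathbf Y:\mathfrak N\to\mathfrak N$ be the $\pi$-almost surely defined map sending $\omega$ to the configuration whose counting process is $t\mapsto Y(\omega,t)$ (with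 an arbitrary fixed value, the empty configuration, where there is no such configuration), and assume $\mathbf Y^{\#}\pi\ll\pi$, where $\mathbf Y^{\#}\pi$ is the image of $\pi$ by $\mathbf Y$. The map $\mathbf Y$ is called left invertible if $\mathbf Y^{\#}\pi\ll\pi$ and there is a measurable map $\mathbb Z:\mathfrak N\to\mathfrak N$ with $\mathbb Z\circ\mathbf Y=\mathrm{Id}_{\mathfrak N}$ $\pi$-a.s. (a left inverse). Then $\mathcal N_{y^*(t)}=\mathcal Y_t$ for all $t\ge 0$ if and only if $\mathbf Y$ admits a left inverse. Likewise, $\mathcal N_{y^*(t)}$ and $\mathcal Y_t$ coincide up to $\pi$-negligible sets for all $t\ge 0$ if and only if $\mathbf Y$ admits a left inverse. -/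

import Mathlib

open MeasureTheory ProbabilityTheory Filter Topology
open scoped NNReal ENNReal

noncomputable section

namespace PoissonTimeChange

/-- A locally finite simple configuration on `(0, +∞)`, given by its set of atoms;
it has finitely many atoms in every interval `(0, t]`. -/
@[ext]
structure Conf where
  atoms : Set ℝ≥0
  zero_notMem : (0 : ℝ≥0) ∉ atoms
  finite_le : ∀ t : ℝ≥0, {x ∈ atoms | x ≤ t}.Finite

namespace Conf

/-- The empty configuration. -/
def empty : Conf where
  atoms := ∅
  zero_notMem := by simp
  finite_le := by simp

/-- The counting function `N(ω, a) = ω([0, a])`, at every time `a ∈ [0, +∞]`. -/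
def count (ω : Conf) (a : ℝ≥0∞) : ℕ∞ :=
  {x ∈ ω.atoms | (x : ℝ≥0∞) ≤ a}.encard

/-- The `σ`-algebra generated by all the counts `N(t)`, `t ≥ 0`. -/
instance : MeasurableSpace Conf :=
  ⨆ t : ℝ≥0, MeasurableSpace.comap (fun ω : Conf => ω.count t) inferInstance

/-- The configuration restricted to `[0, t]`. -/
def restrict (t : ℝ≥0) (ω : Conf) : Conf where
  atoms := {x ∈ ω.atoms | x ≤ t}
  zero_notMem := fun h => ω.zero_notMem h.1
  finite_le := fun s => (ω.finite_le s).subset fun _ hx => ⟨hx.1.1, hx.2⟩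

end Conf

/-- The canonical filtration `𝓝_t = σ(N(s), s ≤ t)`; it is not completed. -/
def canonicalFiltration : Filtration ℝ≥0 (inferInstance : MeasurableSpace Conf) where
  seq t := ⨆ s : ℝ≥0, ⨆ _ : s ≤ t,
    MeasurableSpace.comap (fun ω : Conf => ω.count s) inferInstance
  mono' := fun _ _ hst => iSup_mono fun _ => iSup_mono' fun h => ⟨h.trans hst, le_rfl⟩
  le' := fun _ => iSup_le fun s => iSup_le fun _ =>
    le_iSup (fun t : ℝ≥0 =>
      MeasurableSpace.comap (fun ω : Conf => ω.count t) inferInstance) s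

/-- The configuration whose successive interarrival times are `x 0, x 1, …`; it is empty when
these are not all positive or when the arrival times do not tend to infinity. -/
def arrivalConf (x : ℕ → ℝ) : Conf :=
  open Classical in
  if h : (∀ n, 0 < x n) ∧
      Tendsto (fun n => ∑ i ∈ Finset.range n, x i) atTop atTop then
    { atoms := Set.range fun n : ℕ => (∑ i ∈ Finset.range (n + 1), x i).toNNReal
      zero_notMem := by
        rintro ⟨n, hn⟩
        have : 0 < ∑ i ∈ Finset.range (n + 1), x i :=
          Finset.sum_pos (fun i _ => h.1 i) ⟨0, by simp⟩
        have h2 := Real.toNNReal_eq_zero.1 hn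
        linarith
      finite_le := by
        intro t
        have h1 : ∀ᶠ n in atTop, (t : ℝ) < ∑ i ∈ Finset.range (n + 1), x i :=
          (h.2.comp (tendsto_add_atTop_nat 1)).eventually_gt_atTop _
        obtain ⟨n₀, hn₀⟩ := eventually_atTop.1 h1
        refine ((Set.finite_lt_nat n₀).image
          fun n : ℕ => (∑ i ∈ Finset.range (n + 1), x i).toNNReal).subset ?_
        rintro y ⟨⟨n, rfl⟩, hy⟩
        refine ⟨n, ?_, rfl⟩
        by_contra hn
        have h3 := hn₀ n (not_lt.1 hn)
        exact absurd (Real.toNNReal_le_iff_le_coe.1 hy) (not_le.2 h3) }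
  else Conf.empty

/-- The law `π` on configurations of the unit rate Poisson process: the interarrival times are
independent, exponential with parameter `1`. -/
def poissonLaw : Measure Conf :=
  (Measure.infinitePi fun _ : ℕ => expMeasure 1).map arrivalConf

theorem measurable_of_count {α : Type*} {m : MeasurableSpace α} {f : α → Conf}
    (h : ∀ t : ℝ≥0, Measurable fun a => (f a).count t) : Measurable f := by
  rw [measurable_iff_comap_le]
  change MeasurableSpace.comap f (⨆ t : ℝ≥0,
    MeasurableSpace.comap (fun ω : Conf => ω.count t) inferInstance) ≤ m
  rw [MeasurableSpace.comap_iSup]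
  refine iSup_le fun t => ?_
  rw [MeasurableSpace.comap_comp]
  exact (h t).comap_le

theorem measurable_arrivalConf : Measurable arrivalConf := by
  classical
  have hS : ∀ n, Measurable fun x : ℕ → ℝ => ∑ i ∈ Finset.range n, x i := fun n =>
    Finset.measurable_fun_sum _ fun i _ => measurable_pi_apply i
  have hgood : MeasurableSet {x : ℕ → ℝ | (∀ n, 0 < x n) ∧
      Tendsto (fun n => ∑ i ∈ Finset.range n, x i) atTop atTop} := by
    have h1 : MeasurableSet {x : ℕ → ℝ | ∀ n, 0 < x n} := by
      rw [Set.ofPred_forall]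
      exact MeasurableSet.iInter fun n =>
        measurableSet_lt measurable_const (measurable_pi_apply n)
    exact h1.inter (measurableSet_tendsto _ hS)
  refine measurable_of_count fun t => ?_
  have heq : (fun x => (arrivalConf x).count t) = fun x =>
      if x ∈ {x : ℕ → ℝ | (∀ n, 0 < x n) ∧
        Tendsto (fun n => ∑ i ∈ Finset.range n, x i) atTop atTop}
      then Set.encard {n : ℕ | ∑ i ∈ Finset.range (n + 1), x i ≤ t} else 0 := by
    funext x
    split_ifs with h
    · rw [Set.mem_ofPred_eq] at h
      have hmono : StrictMono fun n : ℕ => ∑ i ∈ Finset.range (n + 1), x i :=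
        strictMono_nat_of_lt_succ fun n => by
          rw [Finset.sum_range_succ _ (n + 1)]
          linarith [h.1 (n + 1)]
      have hnn : ∀ n : ℕ, 0 ≤ ∑ i ∈ Finset.range (n + 1), x i := fun n =>
        Finset.sum_nonneg fun i _ => (h.1 i).le
      have hinj : Function.Injective
          fun n : ℕ => (∑ i ∈ Finset.range (n + 1), x i).toNNReal := fun m n hmn =>
        hmono.injective ((Real.toNNReal_eq_toNNReal_iff (hnn m) (hnn n)).1 hmn)
      rw [← hinj.encard_image]
      unfold Conf.count arrivalConf
      rw [dif_pos h]
      congr 1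
      ext y
      simp only [Set.mem_ofPred_eq, Set.mem_range, Set.mem_image, ENNReal.coe_le_coe]
      constructor
      · rintro ⟨⟨n, rfl⟩, hy⟩
        exact ⟨n, Real.toNNReal_le_iff_le_coe.1 hy, rfl⟩
      · rintro ⟨n, hn, rfl⟩
        exact ⟨⟨n, rfl⟩, Real.toNNReal_le_iff_le_coe.2 hn⟩
    · rw [Set.mem_ofPred_eq] at h
      unfold Conf.count arrivalConf
      rw [dif_neg h]
      simp [Conf.empty]
  rw [heq]
  refine Measurable.ite hgood (measurable_encard.comp ?_) measurable_const
  exact measurable_set_iff.2 fun n =>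
    (measurableSet_le (hS (n + 1)) measurable_const).mem

instance : IsProbabilityMeasure poissonLaw :=
  have := isProbabilityMeasure_expMeasure one_pos
  Measure.isProbabilityMeasure_map measurable_arrivalConf.aemeasurable

/-- The primitive `y(ω, t) = ∫_0^t ẏ(ω, s) ds ∈ [0, +∞]` of a non-negative process `ẏ`. -/
def clock (v : ℝ≥0 → Conf → ℝ) (ω : Conf) (t : ℝ≥0) : ℝ≥0∞ :=
  ∫⁻ s in Set.Ioc (0 : ℝ) t, ENNReal.ofReal (v s.toNNReal ω)

/-- The right inverse `y*(ω, t) = inf {s | y(ω, s) > t}`, with `inf ∅ = +∞`. -/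
def clockInv (v : ℝ≥0 → Conf → ℝ) (t : ℝ≥0) (ω : Conf) : ℝ≥0∞ :=
  ⨅ s : ℝ≥0, ⨅ _ : (t : ℝ≥0∞) < clock v ω s, (s : ℝ≥0∞)

/-- The class `𝒫⁺⁺(𝓝, μ)`. -/
structure MemPpp (v : ℝ≥0 → Conf → ℝ) (μ : Measure Conf) : Prop where
  predictable : IsStronglyPredictable canonicalFiltration v
  pos : ∀ t ω, 0 < v t ω
  finite : ∀ t, ∀ᵐ ω ∂μ, clock v ω t < ∞
  tendsto : ∀ᵐ ω ∂μ, Tendsto (clock v ω) atTop (𝓝 ∞)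

/-! ### Measurability facts: `y*(t)` is a stopping time of the canonical filtration -/

theorem Conf.count_restrict (ω : Conf) (s t : ℝ≥0) :
    (ω.restrict t).count s = ω.count (min s t : ℝ≥0) := by
  unfold Conf.count Conf.restrict
  congr 1
  ext x
  simp only [Set.mem_ofPred_eq, ENNReal.coe_le_coe, le_min_iff]
  tauto

theorem measurable_count_of_le {s t : ℝ≥0} (h : s ≤ t) :
    Measurable[canonicalFiltration t] fun ω : Conf => ω.count s := by
  rw [measurable_iff_comap_le]
  exact le_iSup₂_of_le (f := fun (s : ℝ≥0) (_ : s ≤ t) =>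
    MeasurableSpace.comap (fun ω : Conf => ω.count s) inferInstance) s h le_rfl

theorem measurable_restrict (t : ℝ≥0) :
    Measurable[canonicalFiltration t] (Conf.restrict t) := by
  refine @measurable_of_count _ (canonicalFiltration t) _ fun s => ?_
  simp only [Conf.count_restrict]
  exact measurable_count_of_le (min_le_right s t)

theorem preimage_restrict_of_measurableSet {t : ℝ≥0} {A : Set Conf}
    (hA : MeasurableSet[canonicalFiltration t] A) : Conf.restrict t ⁻¹' A = A := by
  have key : canonicalFiltration t ≤
      MeasurableSpace.invariants (m := ⊤) (Conf.restrict t) := by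
    refine iSup₂_le fun s hs => ?_
    rintro _ ⟨B, -, rfl⟩
    refine ⟨trivial, ?_⟩
    ext ω
    simp [Conf.count_restrict, min_eq_left hs]
  exact (key A hA).2

/-- Events depending only on the restriction to `[0, t]` are those of `𝓝_t`. -/
theorem measurableSet_canonicalFiltration_iff {t : ℝ≥0} {A : Set Conf} :
    MeasurableSet[canonicalFiltration t] A ↔
      MeasurableSet A ∧ Conf.restrict t ⁻¹' A = A := by
  constructor
  · exact fun h => ⟨canonicalFiltration.le t A h, preimage_restrict_of_measurableSet h⟩
  · rintro ⟨h1, h2⟩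
    rw [← h2]
    exact measurable_restrict t h1

/-- The canonical filtration is right continuous. -/
theorem measurableSet_of_forall_gt {t : ℝ≥0} {A : Set Conf}
    (h : ∀ u, t < u → MeasurableSet[canonicalFiltration u] A) :
    MeasurableSet[canonicalFiltration t] A := by
  rw [measurableSet_canonicalFiltration_iff]
  refine ⟨canonicalFiltration.le _ A (h (t + 1) (by simp)), ?_⟩
  ext ω
  obtain ⟨u, hu, hω⟩ : ∃ u, t < u ∧ ω.restrict u = ω.restrict t := by
    have hfin : {x ∈ ω.atoms | t < x ∧ x ≤ t + 1}.Finite :=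
      (ω.finite_le (t + 1)).subset fun x hx => ⟨hx.1, hx.2.2⟩
    have hev : ∀ᶠ u in 𝓝[>] t, ∀ x ∈ {x ∈ ω.atoms | t < x ∧ x ≤ t + 1}, u < x := by
      rw [hfin.eventually_all]
      intro x hx
      exact mem_nhdsWithin_of_mem_nhds (Iio_mem_nhds hx.2.1)
    have hev2 : ∀ᶠ u in 𝓝[>] t, u < t + 1 :=
      mem_nhdsWithin_of_mem_nhds (Iio_mem_nhds (by simp))
    have : (𝓝[>] t).NeBot := nhdsGT_neBot_of_exists_gt ⟨t + 1, by simp⟩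
    obtain ⟨u, h1, h2, h3⟩ := (hev.and (hev2.and self_mem_nhdsWithin)).exists
    refine ⟨u, h3, ?_⟩
    ext x
    simp only [Conf.restrict, Set.mem_ofPred_eq]
    refine and_congr_right fun hx => ⟨fun hxu => ?_, fun hxt => hxt.trans (le_of_lt h3)⟩
    by_contra hxt
    exact absurd (h1 x ⟨hx, not_le.1 hxt, hxu.trans h2.le⟩) (not_lt.2 hxu)
  have h1 := preimage_restrict_of_measurableSet (h u hu)
  rw [Set.mem_preimage, ← hω, ← Set.mem_preimage, h1]

theorem clock_mono (v : ℝ≥0 → Conf → ℝ) (ω : Conf) : Monotone (clock v ω) := fun _ _ h =>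
  lintegral_mono_set (Set.Ioc_subset_Ioc_right (NNReal.coe_le_coe.2 h))

theorem measurable_clock {v : ℝ≥0 → Conf → ℝ}
    (hv : IsStronglyPredictable canonicalFiltration v) (t : ℝ≥0) :
    Measurable[canonicalFiltration t] fun ω => clock v ω t := by
  have h1 := (hv.isStronglyProgressive t).measurable
  let _ : MeasurableSpace Conf := canonicalFiltration t
  have h2 : ∀ ω, clock v ω t = ∫⁻ s : Set.Ioc (0 : ℝ) t,
      ENNReal.ofReal (v (s : ℝ).toNNReal ω) ∂(Measure.comap Subtype.val volume) := fun ω =>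
    (lintegral_subtype_comap measurableSet_Ioc
      fun s : ℝ => ENNReal.ofReal (v s.toNNReal ω)).symm
  simp only [h2]
  have h3 : Measurable fun p : Set.Ioc (0 : ℝ) t × Conf =>
      ((⟨(p.1 : ℝ).toNNReal, Real.toNNReal_le_iff_le_coe.2 p.1.2.2⟩ : Set.Iic t), p.2) :=
    ((measurable_real_toNNReal.comp (measurable_subtype_coe.comp measurable_fst)).subtype_mk).prodMk
      measurable_snd
  have : IsFiniteMeasure (Measure.comap (Subtype.val : Set.Ioc (0 : ℝ) t → ℝ) volume) := by
    refine ⟨?_⟩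
    rw [comap_subtype_coe_apply measurableSet_Ioc, Set.image_univ, Subtype.range_coe]
    exact measure_Ioc_lt_top
  exact Measurable.lintegral_prod_left' (ENNReal.measurable_ofReal.comp (h1.comp h3))

theorem isStoppingTime_clockInv {v : ℝ≥0 → Conf → ℝ}
    (hv : IsStronglyPredictable canonicalFiltration v) (t : ℝ≥0) :
    IsStoppingTime canonicalFiltration (clockInv v t) := by
  intro s
  refine measurableSet_of_forall_gt fun u hu => ?_
  have : (𝓝[>] s).NeBot := nhdsGT_neBot_of_exists_gt ⟨u, hu⟩
  obtain ⟨q, -, hq, hqlim⟩ := exists_seq_strictAnti_tendsto' hu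
  have heq : {ω | clockInv v t ω ≤ (s : ℝ≥0∞)} =
      ⋂ n, {ω | (t : ℝ≥0∞) < clock v ω (q n)} := by
    ext ω
    simp only [Set.mem_ofPred_eq, Set.mem_iInter]
    constructor
    · intro h n
      have h1 : clockInv v t ω < (q n : ℝ≥0∞) :=
        lt_of_le_of_lt h (ENNReal.coe_lt_coe.2 (hq n).1)
      simp only [clockInv, iInf_lt_iff] at h1
      obtain ⟨r, hr, hrq⟩ := h1
      exact lt_of_lt_of_le hr (clock_mono v ω (ENNReal.coe_lt_coe.1 hrq).le)
    · intro h
      refine ge_of_tendsto' (ENNReal.tendsto_coe.2 hqlim) fun n => ?_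
      exact iInf₂_le (q n) (h n)
  change MeasurableSet[canonicalFiltration u] {ω | clockInv v t ω ≤ (s : ℝ≥0∞)}
  rw [heq]
  refine @MeasurableSet.iInter _ _ (canonicalFiltration u) _ _ fun n => ?_
  exact canonicalFiltration.mono (hq n).2.le _ (measurable_clock hv (q n) measurableSet_Ioi)

/-! ### The time change, its filtrations and left invertibility -/

/-- The time-changed filtration `𝓝^{y*}`, that is `𝓝_{y*(t)}`, `t ≥ 0`. -/
abbrev timeChangedSigma {v : ℝ≥0 → Conf → ℝ}
    (hv : IsStronglyPredictable canonicalFiltration v) (t : ℝ≥0) : MeasurableSpace Conf :=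
  (isStoppingTime_clockInv hv t).measurableSpace

/-- The natural filtration `𝒴_t = σ(Y(u), u ≤ t)` of the process `Y(u) = N(y*(u))`. -/
abbrev naturalSigma (v : ℝ≥0 → Conf → ℝ) (t : ℝ≥0) : MeasurableSpace Conf :=
  ⨆ u : ℝ≥0, ⨆ _ : u ≤ t,
    MeasurableSpace.comap (fun ω : Conf => ω.count (clockInv v u ω)) inferInstance

/-- The map `𝐘` sending `ω` to the configuration whose counting function is
`t ↦ N(ω, y*(ω, t))`. Such a configuration exists for almost every `ω`, and it is unique;
where there is none the value is arbitrary. -/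
def timeChange (v : ℝ≥0 → Conf → ℝ) (ω : Conf) : Conf :=
  open Classical in
  if h : ∃ η : Conf, ∀ t : ℝ≥0, η.count t = ω.count (clockInv v t ω) then h.choose
  else Conf.empty

/-- Left invertibility of a map from the space of configurations to itself. -/
def LeftInvertible (μ : Measure Conf) (Y : Conf → Conf) : Prop :=
  μ.map Y ≪ μ ∧ ∃ Z : Conf → Conf, Measurable Z ∧ ∀ᵐ ω ∂μ, Z (Y ω) = ω

end PoissonTimeChange

end

noncomputable section

namespace PoissonTimeChange

namespace Conf

/-! ### The counting function determines the configuration -/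

/-! Both sides of each equivalence hold for every admissible `v`. A predictable process at time `s`
sees only the atoms strictly before `s`, so two configurations that first differ at `s` have the
same clock on `[0, s]`, endpoint included. Positivity makes the clock strictly increasing where it
is finite, so just above its value at `s` the two time-changed counts reduce to the counts at `s`,
which differ (`lt_clock_of_first_difference`). Thus, if the time-changed processes agree up to level
`t`, the common clock exceeds `t` before the first difference: `y*(t)` comes before it, and no event
of `𝓝_{y*(t)}` separates the two configurations. Descriptive set theory turns this pointwise
statement into a measurable one, since `Conf` is standard Borel. A measurable event that is a union
of fibres of a measurable map into a countable product is the preimage of a measurable set, which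
gives the equality of σ-algebras without completion. A measurable injection on a full-measure set
has a measurable inverse by Lusin–Souslin, which gives the left inverse. Absolute continuity is
assumed, and equal σ-algebras have equal completions. -/

theorem count_mono (ω : Conf) : Monotone ω.count := fun _ _ h =>
  Set.encard_le_encard fun _ hx => ⟨hx.1, hx.2.trans h⟩

theorem count_coe (ω : Conf) (t : ℝ≥0) : ω.count t = {x ∈ ω.atoms | x ≤ t}.encard := by
  simp [count]

theorem count_coe_ne_top (ω : Conf) (t : ℝ≥0) : ω.count t ≠ ⊤ := by
  rw [count_coe, Set.encard_ne_top_iff]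
  exact ω.finite_le t

theorem restrict_atoms (ω : Conf) (t : ℝ≥0) : (ω.restrict t).atoms = {x ∈ ω.atoms | x ≤ t} := rfl

theorem count_zero (ω : Conf) : ω.count (0 : ℝ≥0) = 0 := by
  rw [count_coe, Set.encard_eq_zero, Set.eq_empty_iff_forall_notMem]
  rintro x ⟨hx, hx0⟩
  rw [nonpos_iff_eq_zero] at hx0
  exact ω.zero_notMem (hx0 ▸ hx)

/-- Right after any time there is an interval without atoms. -/
theorem exists_gt_forall_atoms (ω : Conf) (t : ℝ≥0) :
    ∃ u > t, ∀ x ∈ ω.atoms, x ≤ u → x ≤ t := by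
  have hfin : {x ∈ ω.atoms | t < x ∧ x ≤ t + 1}.Finite :=
    (ω.finite_le (t + 1)).subset fun x hx => ⟨hx.1, hx.2.2⟩
  have hev : ∀ᶠ u in 𝓝[>] t, ∀ x ∈ {x ∈ ω.atoms | t < x ∧ x ≤ t + 1}, u < x := by
    rw [hfin.eventually_all]
    exact fun x hx => mem_nhdsWithin_of_mem_nhds (Iio_mem_nhds hx.2.1)
  have hev2 : ∀ᶠ u in 𝓝[>] t, u < t + 1 :=
    mem_nhdsWithin_of_mem_nhds (Iio_mem_nhds (by simp))
  have : (𝓝[>] t).NeBot := nhdsGT_neBot_of_exists_gt ⟨t + 1, by simp⟩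
  obtain ⟨u, h1, h2, h3⟩ := (hev.and (hev2.and self_mem_nhdsWithin)).exists
  refine ⟨u, h3, fun x hx hxu => ?_⟩
  by_contra hxt
  exact absurd (h1 x ⟨hx, not_le.1 hxt, hxu.trans h2.le⟩) (not_lt.2 hxu)

/-- The first time at which two distinct configurations differ. -/
theorem exists_first_difference {ω₁ ω₂ : Conf} (h : ω₁ ≠ ω₂) :
    ∃ s, (∀ r < s, r ∈ ω₁.atoms ↔ r ∈ ω₂.atoms) ∧ ¬(s ∈ ω₁.atoms ↔ s ∈ ω₂.atoms) := by
  obtain ⟨a, ha⟩ : ∃ a, ¬(a ∈ ω₁.atoms ↔ a ∈ ω₂.atoms) := by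
    by_contra! h'
    exact h (Conf.ext (Set.ext h'))
  have hfin : {x | ¬(x ∈ ω₁.atoms ↔ x ∈ ω₂.atoms) ∧ x ≤ a}.Finite := by
    refine ((ω₁.finite_le a).union (ω₂.finite_le a)).subset fun x hx => ?_
    have := hx.1
    by_cases h1 : x ∈ ω₁.atoms
    · exact Or.inl ⟨h1, hx.2⟩
    · exact Or.inr ⟨by tauto, hx.2⟩
  obtain ⟨s, hs, hmin⟩ := hfin.exists_minimal ⟨a, ha, le_rfl⟩
  refine ⟨s, fun r hr => ?_, hs.1⟩
  by_contra hne
  exact absurd (hmin ⟨hne, hr.le.trans hs.2⟩ hr.le) (not_le.2 hr)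

theorem count_ne_of_mem_of_notMem {ω₁ ω₂ : Conf} {s : ℝ≥0}
    (h : ∀ r < s, r ∈ ω₁.atoms ↔ r ∈ ω₂.atoms) (h₁ : s ∈ ω₁.atoms) (h₂ : s ∉ ω₂.atoms) :
    ω₁.count s ≠ ω₂.count s := by
  have heq : {x ∈ ω₁.atoms | x ≤ s} = insert s {x ∈ ω₂.atoms | x ≤ s} := by
    ext x
    simp only [Set.mem_ofPred_eq, Set.mem_insert_iff]
    rcases lt_trichotomy x s with hx | rfl | hx
    · simp [h x hx, hx.ne]
    · simp [h₁]
    · simp [hx.ne', not_le.2 hx]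
  have hne := ω₂.count_coe_ne_top s
  rw [count_coe] at hne
  rw [count_coe, count_coe, heq, Set.encard_insert_of_notMem fun h => h₂ h.1]
  exact ((ENat.lt_add_one_iff hne).2 le_rfl).ne'

theorem count_ne_of_first_difference {ω₁ ω₂ : Conf} {s : ℝ≥0}
    (h : ∀ r < s, r ∈ ω₁.atoms ↔ r ∈ ω₂.atoms) (hs : ¬(s ∈ ω₁.atoms ↔ s ∈ ω₂.atoms)) :
    ω₁.count s ≠ ω₂.count s := by
  by_cases h₁ : s ∈ ω₁.atoms
  · exact count_ne_of_mem_of_notMem h h₁ (by tauto)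
  · exact (count_ne_of_mem_of_notMem (fun r hr => (h r hr).symm) (by tauto) h₁).symm

theorem ext_count {ω₁ ω₂ : Conf} (h : ∀ t : ℝ≥0, ω₁.count t = ω₂.count t) : ω₁ = ω₂ := by
  by_contra hne
  obtain ⟨s, h1, h2⟩ := exists_first_difference hne
  exact count_ne_of_first_difference h1 h2 (h s)

/-! ### Arrival times, and the space of configurations as a standard Borel space -/

/-- The time of the `n`-th atom (counting from `0`); it is `+∞` if there is none. -/
def arrival (ω : Conf) (n : ℕ) : ℝ≥0∞ :=
  ⨅ t : ℝ≥0, ⨅ _ : ((n + 1 : ℕ) : ℕ∞) ≤ ω.count t, (t : ℝ≥0∞)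

theorem arrival_le_coe_iff {ω : Conf} {n : ℕ} {t : ℝ≥0} :
    ω.arrival n ≤ t ↔ ((n + 1 : ℕ) : ℕ∞) ≤ ω.count t := by
  refine ⟨fun h => ?_, fun h => iInf₂_le t h⟩
  -- The infimum defining the arrival time is attained because the count is constant just after `t`.
  obtain ⟨u, hu, hω⟩ := ω.exists_gt_forall_atoms t
  have h1 : ω.arrival n < u := h.trans_lt (ENNReal.coe_lt_coe.2 hu)
  simp only [arrival, iInf_lt_iff] at h1
  obtain ⟨r, hr, hru⟩ := h1
  refine hr.trans ?_
  rw [count_coe, count_coe]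
  exact Set.encard_le_encard fun x hx =>
    ⟨hx.1, hω x hx.1 (hx.2.trans (ENNReal.coe_lt_coe.1 hru).le)⟩

/-- The finiteness clause matters only at `a = ∞`, where an absent atom, with arrival time `∞`, must
not be counted. -/
theorem le_count_iff {ω : Conf} {n : ℕ} {a : ℝ≥0∞} :
    ((n + 1 : ℕ) : ℕ∞) ≤ ω.count a ↔ ω.arrival n ≤ a ∧ ω.arrival n < ∞ := by
  induction a with
  | coe t =>
    rw [← arrival_le_coe_iff]
    exact ⟨fun h => ⟨h, h.trans_lt ENNReal.coe_lt_top⟩, And.left⟩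
  | top =>
    simp only [le_top, true_and]
    constructor
    · intro h
      obtain ⟨F, hF, hcard⟩ := Set.exists_subset_encard_eq h
      have hfin : F.Finite := Set.encard_ne_top_iff.1 (by rw [hcard]; exact ENat.natCast_ne_top _)
      obtain ⟨b, hb⟩ := hfin.bddAbove
      have : ω.arrival n ≤ b := by
        rw [arrival_le_coe_iff, ← hcard, count_coe]
        exact Set.encard_le_encard fun x hx => ⟨(hF hx).1, hb hx⟩
      exact this.trans_lt ENNReal.coe_lt_top
    · intro h
      lift ω.arrival n to ℝ≥0 using h.ne with t ht
      exact (arrival_le_coe_iff.1 ht.ge).trans (ω.count_mono le_top)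

theorem measurable_count (t : ℝ≥0) : Measurable fun ω : Conf => ω.count t :=
  (measurable_count_of_le le_rfl).mono (canonicalFiltration.le t) le_rfl

theorem measurable_arrival (n : ℕ) : Measurable fun ω : Conf => ω.arrival n := by
  refine measurable_of_Iic fun a => ?_
  induction a with
  | coe t =>
    have : (fun ω : Conf => ω.arrival n) ⁻¹' Set.Iic (t : ℝ≥0∞) =
        (fun ω : Conf => ω.count t) ⁻¹' Set.Ici ((n + 1 : ℕ) : ℕ∞) := by
      ext ω
      exact arrival_le_coe_iff
    rw [this]
    exact measurable_count t (Set.to_countable _).measurableSet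
  | top => simp

theorem measurable_enat_of_le {α : Type*} [MeasurableSpace α] {f : α → ℕ∞}
    (h : ∀ n : ℕ, MeasurableSet {a | ((n + 1 : ℕ) : ℕ∞) ≤ f a}) : Measurable f := by
  refine ENat.measurable_iff.2 fun n => ?_
  have h' : ∀ n : ℕ, MeasurableSet {a | (n : ℕ∞) ≤ f a} := fun n => by
    cases n with
    | zero => simp
    | succ n => exact h n
  have : f ⁻¹' {(n : ℕ∞)} = {a | (n : ℕ∞) ≤ f a} \ {a | ((n + 1 : ℕ) : ℕ∞) ≤ f a} := by
    ext a
    simp only [Set.mem_preimage, Set.mem_singleton_iff, Set.mem_sdiff, Set.mem_ofPred_eq, not_le]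
    rw [Nat.cast_add, Nat.cast_one, ENat.lt_add_one_iff (ENat.natCast_ne_top n)]
    exact ⟨fun h => ⟨h.ge, h.le⟩, fun h => le_antisymm h.2 h.1⟩
  rw [this]
  exact (h' n).diff (h n)

/-- The count at a random time is measurable. -/
theorem measurable_count_comp {τ : Conf → ℝ≥0∞} (hτ : Measurable τ) :
    Measurable fun ω : Conf => ω.count (τ ω) := by
  refine measurable_enat_of_le fun n => ?_
  simp only [le_count_iff]
  exact (measurableSet_le (measurable_arrival n) hτ).inter
    (measurableSet_lt (measurable_arrival n) measurable_const)

/-- The sequences of arrival times of configurations. -/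
def arrivalSeqs : Set (ℕ → ℝ≥0∞) :=
  {x | 0 < x 0 ∧ (∀ n, x n < x (n + 1) ∨ x n = ∞ ∧ x (n + 1) = ∞) ∧ ⨆ n, x n = ∞}

theorem measurableSet_arrivalSeqs : MeasurableSet arrivalSeqs := by
  have hm : ∀ n : ℕ, Measurable fun x : ℕ → ℝ≥0∞ => x n := fun n => measurable_pi_apply n
  refine (measurableSet_lt measurable_const (hm 0)).inter (MeasurableSet.inter ?_ ?_)
  · change MeasurableSet {x : ℕ → ℝ≥0∞ | ∀ n, x n < x (n + 1) ∨ x n = ∞ ∧ x (n + 1) = ∞}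
    rw [Set.ofPred_forall]
    exact MeasurableSet.iInter fun n => (measurableSet_lt (hm n) (hm (n + 1))).union
      ((hm n (measurableSet_singleton _)).inter (hm (n + 1) (measurableSet_singleton _)))
  · exact Measurable.iSup hm (measurableSet_singleton _)

theorem arrival_mem_arrivalSeqs (ω : Conf) : ω.arrival ∈ arrivalSeqs := by
  refine ⟨?_, fun n => ?_, ?_⟩
  · by_contra h
    have h0 : ω.arrival 0 ≤ (0 : ℝ≥0) := by simpa using h
    rw [arrival_le_coe_iff, count_zero] at h0
    simp at h0
  · by_cases htop : ω.arrival n = ∞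
    · refine Or.inr ⟨htop, top_le_iff.1 (htop ▸ le_iInf₂ fun t ht => ?_)⟩
      exact arrival_le_coe_iff.2 (le_trans (Nat.cast_le.2 (Nat.le_succ (n + 1))) ht)
    refine Or.inl (not_le.1 fun hle => ?_)
    lift ω.arrival n to ℝ≥0 using htop with s hs
    rw [arrival_le_coe_iff, count_coe] at hle
    have hsub : {x ∈ ω.atoms | x ≤ s} ⊆ insert s {x ∈ ω.atoms | x < s} := fun x hx =>
      hx.2.eq_or_lt.imp id fun h => ⟨hx.1, h⟩
    -- If arrivals `n` and `n + 1` were both at most `s`, then `n + 1` atoms would lie strictly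
    -- before `s`, and the last of them would bound arrival `n` strictly below `s`.
    have h1 : ((n + 1 : ℕ) : ℕ∞) ≤ {x ∈ ω.atoms | x < s}.encard := by
      have := (hle.trans (Set.encard_le_encard hsub)).trans (Set.encard_insert_le _ _)
      rw [Nat.cast_add _ 1, Nat.cast_one] at this
      exact (ENat.add_le_add_iff_right ENat.one_ne_top).1 this
    have hfin : {x ∈ ω.atoms | x < s}.Finite :=
      (ω.finite_le s).subset fun x hx => ⟨hx.1, hx.2.le⟩
    have hne : {x ∈ ω.atoms | x < s}.Nonempty := by
      rw [← Set.encard_pos]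
      exact lt_of_lt_of_le (by simp) h1
    obtain ⟨m, hm, hmax⟩ := hfin.exists_maximal hne
    have h2 : ω.arrival n ≤ m := by
      rw [arrival_le_coe_iff, count_coe]
      refine h1.trans (Set.encard_le_encard fun x hx => ⟨hx.1, ?_⟩)
      exact (le_total x m).elim id fun h => hmax hx h
    rw [← hs] at h2
    exact absurd (ENNReal.coe_le_coe.1 h2) (not_le.2 hm.2)
  · refine ENNReal.eq_top_of_forall_nnreal_le fun t => ?_
    lift ω.count t to ℕ using ω.count_coe_ne_top t with k hk
    refine le_trans ?_ (le_iSup _ k)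
    by_contra h
    have h1 := arrival_le_coe_iff.1 (not_le.1 h).le
    rw [← hk] at h1
    exact absurd (Nat.cast_le.1 h1) (by simp)

theorem arrivalSeqs_monotone {x : ℕ → ℝ≥0∞} (hx : x ∈ arrivalSeqs) : Monotone x :=
  monotone_nat_of_le_succ fun n => (hx.2.1 n).elim le_of_lt fun h => h.2 ▸ le_top

theorem arrivalSeqs_lt {x : ℕ → ℝ≥0∞} (hx : x ∈ arrivalSeqs) {m n : ℕ} (hmn : m < n)
    (hm : x m ≠ ∞) : x m < x n :=
  ((hx.2.1 m).resolve_right fun h => hm h.1).trans_le (arrivalSeqs_monotone hx hmn)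

/-- The configuration with given arrival times. -/
def ofArrival (x : arrivalSeqs) : Conf where
  atoms := {s | ∃ n, x.1 n = s}
  zero_notMem := by
    rintro ⟨n, hn⟩
    have := x.2.1.trans_le (arrivalSeqs_monotone x.2 (Nat.zero_le n))
    simp [hn] at this
  finite_le := fun t => by
    obtain ⟨k, hk⟩ : ∃ k, (t : ℝ≥0∞) < x.1 k :=
      lt_iSup_iff.1 (x.2.2.2 ▸ ENNReal.coe_lt_top)
    refine ((Set.finite_lt_nat k).image fun n => (x.1 n).toNNReal).subset ?_
    rintro s ⟨⟨n, hn⟩, hs⟩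
    refine ⟨n, ?_, by simp [hn]⟩
    by_contra hkn
    have := hk.trans_le (arrivalSeqs_monotone x.2 (not_lt.1 hkn))
    rw [hn] at this
    exact absurd (ENNReal.coe_lt_coe.1 this) (not_lt.2 hs)

theorem le_count_ofArrival_iff (x : arrivalSeqs) (n : ℕ) (t : ℝ≥0) :
    ((n + 1 : ℕ) : ℕ∞) ≤ (ofArrival x).count t ↔ x.1 n ≤ t := by
  have hcount : (ofArrival x).count t = {n | x.1 n ≤ t}.encard := by
    have hfin : ∀ n ∈ {n | x.1 n ≤ t}, x.1 n ≠ ∞ := fun n hn =>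
      (lt_of_le_of_lt hn ENNReal.coe_lt_top).ne
    have hinj : Set.InjOn (fun n => (x.1 n).toNNReal) {n | x.1 n ≤ t} := by
      intro m hm n hn hmn
      have heq : x.1 m = x.1 n := (ENNReal.toNNReal_eq_toNNReal_iff' (hfin m hm) (hfin n hn)).1 hmn
      rcases lt_trichotomy m n with h | h | h
      · exact absurd heq (arrivalSeqs_lt x.2 h (hfin m hm)).ne
      · exact h
      · exact absurd heq (arrivalSeqs_lt x.2 h (hfin n hn)).ne'
    rw [← hinj.encard_image, count_coe]
    congr 1
    ext s
    constructor
    · rintro ⟨⟨n, hn⟩, hs⟩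
      exact ⟨n, by simpa [hn] using hs, by simp [hn]⟩
    · rintro ⟨n, hn, rfl⟩
      refine ⟨⟨n, (ENNReal.coe_toNNReal (hfin n hn)).symm⟩, ?_⟩
      rw [← ENNReal.coe_le_coe]
      exact (ENNReal.coe_toNNReal (hfin n hn)).trans_le hn
  rw [hcount]
  constructor
  · intro h
    by_contra hn
    have hsub : {n | x.1 n ≤ t} ⊆ Set.Iio n := fun m hm => by
      by_contra hmn
      exact hn ((arrivalSeqs_monotone x.2 (not_lt.1 hmn)).trans hm)
    have := h.trans (Set.encard_le_encard hsub)
    rw [Set.encard_eq_coe_toFinset_card] at this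
    simp at this
    exact absurd this (by exact_mod_cast (Nat.lt_succ_self n).not_ge)
  · intro hn
    have hsub : Set.Iic n ⊆ {n | x.1 n ≤ t} := fun m hm =>
      (arrivalSeqs_monotone x.2 hm).trans hn
    refine le_trans ?_ (Set.encard_le_encard hsub)
    rw [Set.encard_eq_coe_toFinset_card]
    simp

theorem arrival_ofArrival (x : arrivalSeqs) : (ofArrival x).arrival = x.1 := by
  funext n
  have h : ∀ t : ℝ≥0, (ofArrival x).arrival n ≤ t ↔ x.1 n ≤ t := fun t =>
    arrival_le_coe_iff.trans (le_count_ofArrival_iff x n t)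
  refine le_antisymm ?_ ?_
  · exact ENNReal.le_of_forall_nnreal_lt fun r hr => not_lt.1 fun h' => by
      obtain ⟨q, h1, h2⟩ := ENNReal.lt_iff_exists_nnreal_btwn.1 h'
      exact absurd ((h q).2 h1.le |>.trans_lt h2) (by simp [hr.le])
  · exact le_iInf₂ fun t ht => (le_count_ofArrival_iff x n t).1 ht

theorem measurable_ofArrival : Measurable ofArrival :=
  measurable_of_count fun t => measurable_enat_of_le fun n => by
    simp only [le_count_ofArrival_iff]
    exact measurableSet_le ((measurable_pi_apply n).comp measurable_subtype_coe) measurable_const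

theorem ofArrival_arrival (ω : Conf) : ofArrival ⟨ω.arrival, ω.arrival_mem_arrivalSeqs⟩ = ω := by
  refine ext_count fun t => ENat.eq_of_forall_natCast_le_iff fun n => ?_
  cases n with
  | zero => simp
  | succ n => rw [le_count_ofArrival_iff, arrival_le_coe_iff]

/-- Configurations correspond to their sequences of arrival times. -/
def arrivalEquiv : Conf ≃ᵐ arrivalSeqs where
  toFun ω := ⟨ω.arrival, ω.arrival_mem_arrivalSeqs⟩
  invFun := ofArrival
  left_inv := ofArrival_arrival
  right_inv x := Subtype.ext (arrival_ofArrival x)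
  measurable_toFun := (measurable_pi_iff.2 measurable_arrival).subtype_mk
  measurable_invFun := measurable_ofArrival

/-- The arrival sequences form a Borel subset of a countable product of copies of `[0, ∞]`; their
Polish topology is pulled back along `arrivalEquiv`. Both descriptive set theory arguments below
rest on this. -/
instance : StandardBorelSpace Conf := by
  have := measurableSet_arrivalSeqs.standardBorel
  obtain ⟨τ, hborel, hpolish⟩ := this.polish
  let _ : TopologicalSpace Conf := TopologicalSpace.induced arrivalEquiv τ
  refine ⟨inferInstance, ⟨?_⟩, arrivalEquiv.toEquiv.polishSpace_induced⟩
  refine Eq.trans ?_ borel_comap.symm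
  rw [← hborel.measurable_eq]
  exact arrivalEquiv.measurableEmbedding.comap_eq.symm

end Conf

/-! ### Predictable processes and their clocks -/

/-- A predictable process depends at time `s` only on the atoms before `s`. -/
theorem predictable_congr {v : ℝ≥0 → Conf → ℝ}
    (hv : IsStronglyPredictable canonicalFiltration v) {s : ℝ≥0} {ω₁ ω₂ : Conf}
    (h : ∀ r < s, r ∈ ω₁.atoms ↔ r ∈ ω₂.atoms) : v s ω₁ = v s ω₂ := by
  have hrestrict : ∀ i : ℝ≥0, i < s ∨ i = 0 → ω₁.restrict i = ω₂.restrict i := by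
    intro i hi
    ext x
    simp only [Conf.restrict_atoms, Set.mem_ofPred_eq]
    refine and_congr_left fun hx => ?_
    rcases hi with hi | rfl
    · exact h x (hx.trans_lt hi)
    · rw [nonpos_iff_eq_zero] at hx
      subst hx
      exact iff_of_false ω₁.zero_notMem ω₂.zero_notMem
  have hA : ∀ (i : ℝ≥0) (A : Set Conf), MeasurableSet[canonicalFiltration i] A →
      (i < s ∨ i = 0) → (ω₁ ∈ A ↔ ω₂ ∈ A) := by
    intro i A hA hi
    rw [← preimage_restrict_of_measurableSet hA, Set.mem_preimage, Set.mem_preimage,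
      hrestrict i hi]
  -- The generators are `{0} × A` with `A ∈ 𝓝_0` and `(i, ∞) × A` with `A ∈ 𝓝_i`. At time `s` only
  -- those with `i = 0` or `i < s` matter, and such `A` cannot see an atom at `s > 0`.
  have key : ∀ S : Set (ℝ≥0 × Conf), MeasurableSet[canonicalFiltration.predictable] S →
      ((s, ω₁) ∈ S ↔ (s, ω₂) ∈ S) := by
    intro S hS
    refine MeasurableSpace.generateFrom_induction _
      (fun (S : Set (ℝ≥0 × Conf)) _ => (s, ω₁) ∈ S ↔ (s, ω₂) ∈ S) ?_ ?_ ?_ ?_ S hS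
    · rintro _ (⟨A, hA', rfl⟩ | ⟨i, A, hA', rfl⟩) -
      · exact and_congr_right fun _ => hA _ A hA' (Or.inr rfl)
      · exact and_congr_right fun hi => hA i A hA' (Or.inl hi)
    · simp
    · exact fun S _ hS => not_congr hS
    · intro f _ hf
      simp only [Set.mem_iUnion]
      exact exists_congr hf
  have hm := (StronglyMeasurable.measurable hv) (measurableSet_singleton (v s ω₁))
  exact (((key _ hm).1 rfl : v s ω₂ = v s ω₁)).symm

theorem measurable_section {v : ℝ≥0 → Conf → ℝ}
    (hv : IsStronglyPredictable canonicalFiltration v) (ω : Conf) :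
    Measurable fun t => v t ω := by
  have hle : canonicalFiltration.predictable ≤
      (inferInstance : MeasurableSpace (ℝ≥0 × Conf)) := by
    refine MeasurableSpace.generateFrom_le ?_
    rintro _ (⟨A, hA, rfl⟩ | ⟨i, A, hA, rfl⟩)
    · exact (measurableSet_singleton _).prod (canonicalFiltration.le _ A hA)
    · exact measurableSet_Ioi.prod (canonicalFiltration.le _ A hA)
  exact ((StronglyMeasurable.measurable hv).mono hle le_rfl).comp measurable_prodMk_right

theorem clock_zero (v : ℝ≥0 → Conf → ℝ) (ω : Conf) : clock v ω 0 = 0 := by simp [clock]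

theorem clock_congr {v : ℝ≥0 → Conf → ℝ}
    (hv : IsStronglyPredictable canonicalFiltration v) {s : ℝ≥0} {ω₁ ω₂ : Conf}
    (h : ∀ r < s, r ∈ ω₁.atoms ↔ r ∈ ω₂.atoms) {r : ℝ≥0} (hr : r ≤ s) :
    clock v ω₁ r = clock v ω₂ r := by
  refine setLIntegral_congr_fun measurableSet_Ioc fun x hx => ?_
  have hx' : x.toNNReal ≤ s := (Real.toNNReal_le_iff_le_coe.2 hx.2).trans hr
  simp only [predictable_congr hv fun r hr => h r (hr.trans_le hx')]

/-- The increment integrates a positive function over an interval of positive length; finiteness at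
`s` excludes `∞ < ∞`. -/
theorem clock_lt_clock {v : ℝ≥0 → Conf → ℝ}
    (hv : IsStronglyPredictable canonicalFiltration v) (hpos : ∀ t ω, 0 < v t ω) {ω : Conf}
    {s t : ℝ≥0} (hst : s < t) (hs : clock v ω s ≠ ∞) : clock v ω s < clock v ω t := by
  have hunion : Set.Ioc (0 : ℝ) t = Set.Ioc (0 : ℝ) s ∪ Set.Ioc (s : ℝ) t :=
    (Set.Ioc_union_Ioc_eq_Ioc s.2 (NNReal.coe_le_coe.2 hst.le)).symm
  have hm : Measurable fun x : ℝ => ENNReal.ofReal (v x.toNNReal ω) :=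
    ENNReal.measurable_ofReal.comp ((measurable_section hv ω).comp measurable_real_toNNReal)
  have hadd : clock v ω t =
      clock v ω s + ∫⁻ x in Set.Ioc (s : ℝ) t, ENNReal.ofReal (v x.toNNReal ω) := by
    unfold clock
    rw [hunion, lintegral_union measurableSet_Ioc]
    exact Set.Ioc_disjoint_Ioc_of_le le_rfl
  rw [hadd]
  refine ENNReal.lt_add_right hs (ne_of_gt ?_)
  rw [setLIntegral_pos_iff hm]
  have hsupp : Function.support (fun x : ℝ => ENNReal.ofReal (v x.toNNReal ω)) = Set.univ :=
    Set.eq_univ_of_forall fun x => (ENNReal.ofReal_pos.2 (hpos _ _)).ne'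
  rw [hsupp, Set.univ_inter, Real.volume_Ioc]
  simpa using hst

/-- Left continuity of the clock, by monotone convergence; it remains valid when the clock takes the
value `∞`. -/
theorem exists_lt_of_lt_clock {v : ℝ≥0 → Conf → ℝ} {ω : Conf} {s : ℝ≥0} {a : ℝ≥0∞}
    (h : a < clock v ω s) : ∃ r < s, a < clock v ω r := by
  have hs : 0 < s := by
    rw [pos_iff_ne_zero]
    rintro rfl
    simp [clock_zero] at h
  obtain ⟨q, hq, hqs, hlim⟩ := exists_seq_strictMono_tendsto' hs
  have hunion : Set.Ioo (0 : ℝ) s = ⋃ n, Set.Ioc (0 : ℝ) (q n) := by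
    ext x
    simp only [Set.mem_Ioo, Set.mem_iUnion, Set.mem_Ioc, exists_and_left]
    refine and_congr_right fun hx => ⟨fun hxs => ?_, ?_⟩
    · have h1 : x.toNNReal < s := (Real.toNNReal_lt_iff_lt_coe hx.le).2 hxs
      obtain ⟨n, hn⟩ := (hlim.eventually_const_lt h1).exists
      exact ⟨n, Real.toNNReal_le_iff_le_coe.1 hn.le⟩
    · rintro ⟨n, hn⟩
      exact hn.trans_lt (NNReal.coe_lt_coe.2 (hqs n).2)
  have hsup : clock v ω s = ⨆ n, clock v ω (q n) := by
    unfold clock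
    rw [setLIntegral_congr Ioo_ae_eq_Ioc.symm, hunion]
    refine setLIntegral_iUnion_of_directed _ (Monotone.directed_le fun m n hmn => ?_)
    exact Set.Ioc_subset_Ioc_right (NNReal.coe_le_coe.2 (hq.monotone hmn))
  rw [hsup, lt_iSup_iff] at h
  obtain ⟨n, hn⟩ := h
  exact ⟨q n, (hqs n).2, hn⟩

theorem coe_le_clockInv_iff {v : ℝ≥0 → Conf → ℝ} {ω : Conf} {x t : ℝ≥0} :
    (x : ℝ≥0∞) ≤ clockInv v t ω ↔ clock v ω x ≤ t := by
  constructor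
  · intro h
    by_contra hlt
    obtain ⟨r, hrx, hr⟩ := exists_lt_of_lt_clock (not_le.1 hlt)
    exact absurd (h.trans (iInf₂_le r hr)) (not_le.2 (ENNReal.coe_lt_coe.2 hrx))
  · intro h
    refine le_iInf₂ fun r hr => ENNReal.coe_le_coe.2 ?_
    by_contra hrx
    exact absurd (hr.trans_le ((clock_mono v ω (not_le.1 hrx).le).trans h)) (lt_irrefl _)

/-- The time-changed process counts the atoms through the values of the clock. -/
theorem count_clockInv (v : ℝ≥0 → Conf → ℝ) (ω : Conf) (t : ℝ≥0) :
    ω.count (clockInv v t ω) = {x ∈ ω.atoms | clock v ω x ≤ t}.encard := by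
  simp only [Conf.count, coe_le_clockInv_iff]

theorem count_clockInv_eq_count {v : ℝ≥0 → Conf → ℝ} {ω : Conf} {s s' t : ℝ≥0}
    (hgap : ∀ x ∈ ω.atoms, x ≤ s' → x ≤ s) (h₁ : clock v ω s ≤ t) (h₂ : t < clock v ω s') :
    ω.count (clockInv v t ω) = ω.count s := by
  rw [count_clockInv, Conf.count_coe]
  congr 1
  ext x
  refine and_congr_right fun hx => ⟨fun h => hgap x hx ?_, fun h => (clock_mono v ω h).trans h₁⟩
  by_contra hlt
  exact absurd ((h₂.trans_le (clock_mono v ω (not_le.1 hlt).le)).trans_le h) (lt_irrefl _)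

theorem clockInv_mono (v : ℝ≥0 → Conf → ℝ) (ω : Conf) : Monotone fun t => clockInv v t ω :=
  fun _ _ hst => iInf_mono fun _ => iInf_mono' fun h =>
    ⟨(ENNReal.coe_le_coe.2 hst).trans_lt h, le_rfl⟩

theorem measurable_clockInv {v : ℝ≥0 → Conf → ℝ}
    (hv : IsStronglyPredictable canonicalFiltration v) (t : ℝ≥0) :
    Measurable (clockInv v t) := by
  refine measurable_of_Iic fun a => ?_
  induction a with
  | coe r => exact canonicalFiltration.le r _ (isStoppingTime_clockInv hv t r)
  | top => simp

/-! ### The time-changed process determines the configuration -/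

/-- If two configurations have the same time-changed process up to time `t`, then their common
clock has passed `t` before they first differ. -/
theorem lt_clock_of_first_difference {v : ℝ≥0 → Conf → ℝ}
    (hv : IsStronglyPredictable canonicalFiltration v) (hpos : ∀ t ω, 0 < v t ω)
    {ω₁ ω₂ : Conf} {s t : ℝ≥0}
    (h : ∀ q : ℚ, ω₁.count (clockInv v (min (q : ℝ).toNNReal t) ω₁) =
      ω₂.count (clockInv v (min (q : ℝ).toNNReal t) ω₂))
    (hs : ∀ r < s, r ∈ ω₁.atoms ↔ r ∈ ω₂.atoms) (hne : ¬(s ∈ ω₁.atoms ↔ s ∈ ω₂.atoms)) :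
    (t : ℝ≥0∞) < clock v ω₁ s := by
  by_contra hle
  rw [not_lt] at hle
  have hclock : clock v ω₂ s = clock v ω₁ s := (clock_congr hv hs le_rfl).symm
  have hfin : clock v ω₁ s ≠ ∞ := (hle.trans_lt ENNReal.coe_lt_top).ne
  obtain ⟨s₁, hs₁, hgap₁⟩ := ω₁.exists_gt_forall_atoms s
  obtain ⟨s₂, hs₂, hgap₂⟩ := ω₂.exists_gt_forall_atoms s
  have hlt₁ := clock_lt_clock hv hpos hs₁ hfin
  have hlt₂ := clock_lt_clock hv hpos hs₂ (hclock ▸ hfin)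
  rw [hclock] at hlt₂
  -- A level above the common clock value at `s` which neither clock reaches before the end of its
  -- atom-free gap. Rational levels suffice, so countably many counts determine the process.
  obtain ⟨q, hq, hq'⟩ : ∃ q : ℚ, clock v ω₁ s < ((q : ℝ).toNNReal : ℝ≥0∞) ∧
      ((q : ℝ).toNNReal : ℝ≥0∞) < min (clock v ω₁ s₁) (clock v ω₂ s₂) := by
    obtain ⟨q, -, hq⟩ := ENNReal.lt_iff_exists_rat_btwn.1 (lt_min hlt₁ hlt₂)
    exact ⟨q, hq⟩
  -- Capping by `t` keeps the level at or above the clock value at `s`, by the assumption being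
  -- refuted.
  have hmin : clock v ω₁ s ≤ (min (q : ℝ).toNNReal t : ℝ≥0) := by
    rw [ENNReal.coe_min]
    exact le_min hq.le hle
  have hmin' : ((min (q : ℝ).toNNReal t : ℝ≥0) : ℝ≥0∞) < min (clock v ω₁ s₁) (clock v ω₂ s₂) :=
    (ENNReal.coe_le_coe.2 (min_le_left _ _)).trans_lt hq'
  refine Conf.count_ne_of_first_difference hs hne ?_
  rw [← count_clockInv_eq_count hgap₁ hmin (hmin'.trans_le (min_le_left _ _)),
    ← count_clockInv_eq_count hgap₂ (hclock.trans_le hmin) (hmin'.trans_le (min_le_right _ _))]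
  exact h q

/-- Configurations with the same time-changed process up to time `t` belong to the same events
of `𝓝_{y*(t)}`. -/
theorem mem_of_count_clockInv_eq {v : ℝ≥0 → Conf → ℝ}
    (hv : IsStronglyPredictable canonicalFiltration v) (hpos : ∀ t ω, 0 < v t ω)
    {t : ℝ≥0} {A : Set Conf} (hA : MeasurableSet[timeChangedSigma hv t] A) {ω₁ ω₂ : Conf}
    (h : ∀ q : ℚ, ω₁.count (clockInv v (min (q : ℝ).toNNReal t) ω₁) =
      ω₂.count (clockInv v (min (q : ℝ).toNNReal t) ω₂)) (h₁ : ω₁ ∈ A) : ω₂ ∈ A := by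
  by_cases hne : ω₁ = ω₂
  · exact hne ▸ h₁
  obtain ⟨s, hs, hdiff⟩ := Conf.exists_first_difference hne
  obtain ⟨r, hrs, hr⟩ := exists_lt_of_lt_clock (lt_clock_of_first_difference hv hpos h hs hdiff)
  have hinv := preimage_restrict_of_measurableSet (hA.2 r)
  have hrestrict : ω₁.restrict r = ω₂.restrict r := by
    ext x
    simp only [Conf.restrict_atoms, Set.mem_ofPred_eq]
    exact and_congr_left fun hx => hs x (hx.trans_lt hrs)
  -- At `r < s` the clock already exceeds `t`, so `y*(t) ≤ r`; the event `A ∩ {y*(t) ≤ r}` lies in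
  -- `𝓝_r`, hence depends only on the restriction to `[0, r]`.
  have hmem : ω₁ ∈ Conf.restrict r ⁻¹' (A ∩ {ω | clockInv v t ω ≤ (r : ℝ≥0∞)}) := by
    refine hinv.symm ▸ ⟨h₁, ?_⟩
    exact iInf₂_le (f := fun (r : ℝ≥0) (_ : (t : ℝ≥0∞) < clock v ω₁ r) => (r : ℝ≥0∞)) r hr
  rw [Set.mem_preimage, hrestrict, ← Set.mem_preimage] at hmem
  exact (hinv.subset hmem).1

/-! ### The two filtrations coincide -/

/-- Events of the σ-algebra at a stopping time are required to lie in this supremum, which controls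
them on `{y*(t) = ∞}`. -/
theorem iSup_canonicalFiltration :
    ⨆ t, (canonicalFiltration t : MeasurableSpace Conf) = Conf.instMeasurableSpace :=
  le_antisymm (iSup_le canonicalFiltration.le) <| iSup_mono fun t =>
    (measurable_count_of_le (le_refl t)).comap_le

theorem timeChangedSigma_le_naturalSigma {v : ℝ≥0 → Conf → ℝ}
    (hv : IsStronglyPredictable canonicalFiltration v) (hpos : ∀ t ω, 0 < v t ω) (t : ℝ≥0) :
    timeChangedSigma hv t ≤ naturalSigma v t := by
  intro A hA
  let f : Conf → ℚ → ℕ∞ := fun ω q => ω.count (clockInv v (min (q : ℝ).toNNReal t) ω)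
  have hf : Measurable f := measurable_pi_iff.2 fun q =>
    Conf.measurable_count_comp (measurable_clockInv hv _)
  have hf' : Measurable[naturalSigma v t] f := by
    refine @measurable_pi_lambda _ _ _ (naturalSigma v t) _ _ fun q => ?_
    rw [measurable_iff_comap_le]
    exact le_iSup₂_of_le (f := fun (u : ℝ≥0) (_ : u ≤ t) =>
      MeasurableSpace.comap (fun ω : Conf => ω.count (clockInv v u ω)) inferInstance)
      (min (q : ℝ).toNNReal t) (min_le_right _ _) le_rfl
  -- `A` is a union of fibres of `f`. As `f` is measurable from a standard Borel space, the
  -- measurability of `A` descends to the range of `f`, although `f '' A` itself need not be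
  -- measurable.
  have hsat : f ⁻¹' (f '' A) = A := by
    refine (Set.subset_preimage_image f A).antisymm' ?_
    rintro ω₂ ⟨ω₁, h₁, heq⟩
    exact mem_of_count_clockInv_eq hv hpos hA (congrFun heq) h₁
  have hmeas : MeasurableSet (f ⁻¹' (f '' A)) :=
    hsat.symm ▸ (isStoppingTime_clockInv hv t).measurableSpace_le A hA
  obtain ⟨B, hB, hBA⟩ := hf.measurableSet_preimage_iff_preimage_val.1 hmeas
  have hBA' : f ⁻¹' B = A := by
    rw [← hsat]
    ext ω
    exact Set.ext_iff.1 hBA ⟨f ω, ω, rfl⟩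
  rw [← hBA']
  exact hf' hB

/-- On `{y*(u) ≤ i}`, restricting the configuration to `[0, i]` changes neither `y*(u)` nor the
count at that time. -/
theorem naturalSigma_le_timeChangedSigma {v : ℝ≥0 → Conf → ℝ}
    (hv : IsStronglyPredictable canonicalFiltration v) (t : ℝ≥0) :
    naturalSigma v t ≤ timeChangedSigma hv t := by
  refine iSup₂_le fun u hu => ?_
  refine le_trans ?_ ((isStoppingTime_clockInv hv u).measurableSpace_mono
    (isStoppingTime_clockInv hv t) fun ω => clockInv_mono v ω hu)
  rintro _ ⟨B, hB, rfl⟩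
  have hmeas := Conf.measurable_count_comp (measurable_clockInv hv u) hB
  refine ⟨by rwa [iSup_canonicalFiltration], fun i => ?_⟩
  rw [measurableSet_canonicalFiltration_iff]
  refine ⟨hmeas.inter (measurable_clockInv hv u measurableSet_Iic), ?_⟩
  have hle : ∀ (ω : Conf) (j : ℝ≥0), j ≤ i →
      (clockInv v u (ω.restrict i) ≤ j ↔ clockInv v u ω ≤ j) := fun ω j hj =>
    Set.ext_iff.1 (preimage_restrict_of_measurableSet
      (canonicalFiltration.mono hj _ (isStoppingTime_clockInv hv u j))) ω
  ext ω
  change (_ ∈ B ∧ clockInv v u (ω.restrict i) ≤ (i : ℝ≥0∞)) ↔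
    (_ ∈ B ∧ clockInv v u ω ≤ (i : ℝ≥0∞))
  rw [hle ω i le_rfl]
  refine and_congr_left fun hi => ?_
  have hi' := (hle ω i le_rfl).2 hi
  lift clockInv v u ω to ℝ≥0 using (hi.trans_lt ENNReal.coe_lt_top).ne with a ha
  lift clockInv v u (ω.restrict i) to ℝ≥0 using (hi'.trans_lt ENNReal.coe_lt_top).ne with b hb
  -- The events `{y*(u) ≤ j}` with `j ≤ i` are unaffected by the restriction; taking `j = a` and `j
  -- = b` gives both inequalities.
  have hab : b = a := by
    refine le_antisymm ?_ ?_
    · have := (hle ω a (ENNReal.coe_le_coe.1 hi)).2 ha.ge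
      rwa [← hb, ENNReal.coe_le_coe] at this
    · have := (hle ω b (ENNReal.coe_le_coe.1 hi')).1 hb.ge
      rwa [← ha, ENNReal.coe_le_coe] at this
  rw [hab, Conf.count_restrict, min_eq_left (ENNReal.coe_le_coe.1 hi)]

/-- For a positive predictable intensity `𝓝_{y*(t)}` is generated by the time-changed process. -/
theorem timeChangedSigma_eq_naturalSigma {v : ℝ≥0 → Conf → ℝ}
    (hv : IsStronglyPredictable canonicalFiltration v) (hpos : ∀ t ω, 0 < v t ω) (t : ℝ≥0) :
    timeChangedSigma hv t = naturalSigma v t :=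
  le_antisymm (timeChangedSigma_le_naturalSigma hv hpos t) (naturalSigma_le_timeChangedSigma hv t)

/-! ### Left invertibility -/

theorem count_timeChange {v : ℝ≥0 → Conf → ℝ}
    (hv : IsStronglyPredictable canonicalFiltration v) (hpos : ∀ t ω, 0 < v t ω) {ω : Conf}
    (hfin : ∀ t, clock v ω t ≠ ∞) (hlim : Tendsto (clock v ω) atTop (𝓝 ∞)) (t : ℝ≥0) :
    (timeChange v ω).count t = ω.count (clockInv v t ω) := by
  have hstrict : StrictMono (clock v ω) := fun s t hst => clock_lt_clock hv hpos hst (hfin s)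
  have hcoe : ∀ x, ((clock v ω x).toNNReal : ℝ≥0∞) = clock v ω x := fun x =>
    ENNReal.coe_toNNReal (hfin x)
  have hinj : Function.Injective fun x => (clock v ω x).toNNReal := fun x y hxy =>
    hstrict.injective ((ENNReal.toNNReal_eq_toNNReal_iff' (hfin x) (hfin y)).1 hxy)
  -- The atoms are pushed forward by the clock, here a finite, strictly increasing function
  -- vanishing at `0` and tending to `∞`.
  let η : Conf :=
    { atoms := (fun x => (clock v ω x).toNNReal) '' ω.atoms
      zero_notMem := by
        rintro ⟨x, hx, hx0⟩
        have h0 : clock v ω x = 0 := by rw [← hcoe x]; exact_mod_cast hx0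
        have hx : 0 < x := pos_iff_ne_zero.2 fun h => ω.zero_notMem (h ▸ hx)
        exact absurd (h0 ▸ hstrict hx) not_lt_zero
      finite_le := fun u => by
        obtain ⟨S, hS⟩ := (hlim.eventually_const_lt (ENNReal.coe_lt_top (r := u))).exists
        refine ((ω.finite_le S).image fun x => (clock v ω x).toNNReal).subset ?_
        rintro _ ⟨⟨x, hx, rfl⟩, hxu⟩
        have hxu' : clock v ω x ≤ u := hcoe x ▸ ENNReal.coe_le_coe.2 hxu
        exact ⟨x, ⟨hx, (hstrict.lt_iff_lt.1 (hxu'.trans_lt hS)).le⟩, rfl⟩ }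
  have hη : ∀ t : ℝ≥0, η.count t = ω.count (clockInv v t ω) := fun t => by
    rw [count_clockInv, ← hinj.encard_image, Conf.count_coe]
    congr 1
    ext u
    simp only [Set.mem_ofPred_eq, Set.mem_image, η]
    constructor
    · rintro ⟨⟨x, hx, rfl⟩, hxu⟩
      exact ⟨x, ⟨hx, hcoe x ▸ ENNReal.coe_le_coe.2 hxu⟩, rfl⟩
    · rintro ⟨x, ⟨hx, hxu⟩, rfl⟩
      exact ⟨⟨x, hx, rfl⟩, ENNReal.coe_le_coe.1 (hcoe x ▸ hxu)⟩
  have h : ∃ η : Conf, ∀ t : ℝ≥0, η.count t = ω.count (clockInv v t ω) := ⟨η, hη⟩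
  rw [timeChange, dif_pos h]
  exact h.choose_spec t

theorem timeChange_injOn {v : ℝ≥0 → Conf → ℝ}
    (hv : IsStronglyPredictable canonicalFiltration v) (hpos : ∀ t ω, 0 < v t ω) :
    Set.InjOn (timeChange v)
      {ω | (∀ t, clock v ω t ≠ ∞) ∧ Tendsto (clock v ω) atTop (𝓝 ∞)} := by
  intro ω₁ h₁ ω₂ h₂ heq
  by_contra hne
  obtain ⟨s, hs, hdiff⟩ := Conf.exists_first_difference hne
  refine lt_irrefl (clock v ω₁ s) ?_
  -- The level is the clock value at the first difference itself, so the conclusion is that this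
  -- value exceeds itself.
  have := lt_clock_of_first_difference (t := (clock v ω₁ s).toNNReal) hv hpos (fun q => ?_) hs hdiff
  · rwa [ENNReal.coe_toNNReal (h₁.1 s)] at this
  · rw [← count_timeChange hv hpos h₁.1 h₁.2, ← count_timeChange hv hpos h₂.1 h₂.2, heq]

/-- The time change has a measurable left inverse up to negligible sets. -/
theorem exists_measurable_leftInverse_timeChange {v : ℝ≥0 → Conf → ℝ} {μ : Measure Conf}
    (hv : MemPpp v μ) : ∃ Z : Conf → Conf, Measurable Z ∧ ∀ᵐ ω ∂μ, Z (timeChange v ω) = ω := by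
  have hae : ∀ᵐ ω ∂μ, (∀ t, clock v ω t ≠ ∞) ∧ Tendsto (clock v ω) atTop (𝓝 ∞) := by
    filter_upwards [ae_all_iff.2 fun n : ℕ => hv.finite n, hv.tendsto] with ω h1 h2
    refine ⟨fun t => ?_, h2⟩
    obtain ⟨n, hn⟩ := exists_nat_ge t
    exact ((clock_mono v ω hn).trans_lt (h1 n)).ne
  obtain ⟨G, hG, hGm, hgood⟩ := hae.exists_measurable_mem
  have := hGm.standardBorel
  have hmeas : Measurable fun ω : G => timeChange v ω := by
    refine measurable_of_count fun t => ?_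
    have heq : (fun ω : G => (timeChange v ω).count t) =
        fun ω : G => (ω : Conf).count (clockInv v t ω) := funext fun ω =>
      count_timeChange hv.predictable hv.pos (hgood ω ω.2).1 (hgood ω ω.2).2 t
    rw [heq]
    exact (Conf.measurable_count_comp (measurable_clockInv hv.predictable t)).comp
      measurable_subtype_coe
  have hinj : Function.Injective fun ω : G => timeChange v ω := fun ω₁ ω₂ h =>
    Subtype.ext (timeChange_injOn hv.predictable hv.pos (hgood ω₁ ω₁.2) (hgood ω₂ ω₂.2) h)
  -- By Lusin–Souslin the restriction to `G` is a measurable embedding; its inverse extends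
  -- measurably to all of `Conf`.
  obtain ⟨Z, hZ, hZY⟩ := (hmeas.measurableEmbedding hinj).exists_measurable_extend
    measurable_subtype_coe fun ω => ⟨ω⟩
  exact ⟨Z, hZ, Filter.mem_of_superset hG fun ω hω => congrFun hZY ⟨ω, hω⟩⟩

end PoissonTimeChange
end
/-- Since `ẏ` is positive and predictable, the first time at which two configurations differ is
visible in their time changes. Hence, for every such `ẏ`, the two filtrations coincide and the
time change is left invertible as soon as it preserves negligible sets. -/
theorem mainTheorem9 (v : ℝ≥0 → PoissonTimeChange.Conf → ℝ)
    (hv : PoissonTimeChange.MemPpp v PoissonTimeChange.poissonLaw)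
    (hY : PoissonTimeChange.poissonLaw.map (PoissonTimeChange.timeChange v) ≪
      PoissonTimeChange.poissonLaw) :
    ((∀ t : ℝ≥0, PoissonTimeChange.timeChangedSigma hv.predictable t =
        PoissonTimeChange.naturalSigma v t) ↔
      PoissonTimeChange.LeftInvertible PoissonTimeChange.poissonLaw
        (PoissonTimeChange.timeChange v)) ∧
    ((∀ t : ℝ≥0,
        eventuallyMeasurableSpace (PoissonTimeChange.timeChangedSigma hv.predictable t)
          (ae PoissonTimeChange.poissonLaw) =
        eventuallyMeasurableSpace (PoissonTimeChange.naturalSigma v t)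
          (ae PoissonTimeChange.poissonLaw)) ↔
      PoissonTimeChange.LeftInvertible PoissonTimeChange.poissonLaw
        (PoissonTimeChange.timeChange v)) := by
  have hinv : PoissonTimeChange.LeftInvertible PoissonTimeChange.poissonLaw
      (PoissonTimeChange.timeChange v) :=
    ⟨hY, PoissonTimeChange.exists_measurable_leftInverse_timeChange hv⟩
  have heq := PoissonTimeChange.timeChangedSigma_eq_naturalSigma hv.predictable hv.pos
  exact ⟨iff_of_true heq hinv, iff_of_true (fun t => by rw [heq t]) hinv⟩
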